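/- Let $n\ge 0$ be an integer. A function $f:\{\pm1\}^n\to\{\pm1\}$ is called a threshold function if there are real numbers $\alpha_0,\alpha_1,\dots,\alpha_n$ such that $f(x_1,\dots,x_n)=1$ if and only if $\alpha_1x_1+\dots+\alpha_nx_n+\alpha_0\ge 0$. Let $P(2,n)$ be the number of threshold functions $\{\pm1\}^n\to\{\pm1\}$. Let $$E=\{(1,b_1,\dots,b_n)\in\mathbb R^{n+1} : b_i=\pm1,\ i=1,\dots,n\},$$ and let $E^{\times n}_{\neq0}$ be the set of ordered $n$-tuples $W=(w_1,\dots,w_n)$ of vectors of $E$ with $\dim\operatorname{span}(w_1,\dots,w_n)=n$. For $W\in E^{\times n}_{\neq 0}$ and $0\le l\le n$ put $L_l(W)=\operatorname{span}(w_{n-l+1},\dots,w_n)$ and $q_l^W=|L_l(W)\cap E|$. Then for every family of real weights $p=(p_v)_{v\in E}$ with $\sum_{v\in E}p_v=1$, $$P(2,n)\;\ge\;2\sum_{W\in E^{\times n}_{\neq0}}\frac{1-\sum_{v\in L_n(W)\cap E}p_v}{q_n^W\,q_{n-1}^W\cdots q_1^W},$$ and the right-hand side does not depend on the choice of $p$: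 it takes the same value for any two families of real weights on $E$ with sum $1$. -/

import Mathlib

/-!
The two-element set `{1, -1}` is modelled by the units `ℤˣ` of the integers.
-/

noncomputable section

open scoped Classical

/-- `f : {±1}ⁿ → {±1}` is a threshold function if there are real numbers `α₀, α₁, …, αₙ` with
`f x = 1 ↔ α₁ x₁ + ⋯ + αₙ xₙ + α₀ ≥ 0`. -/
def IsThreshold {n : ℕ} (f : (Fin n → ℤˣ) → ℤˣ) : Prop :=
  ∃ (α₀ : ℝ) (α : Fin n → ℝ), ∀ x : Fin n → ℤˣ,
    f x = 1 ↔ (∑ i, α i * ((x i : ℤ) : ℝ)) + α₀ ≥ 0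

/-- `P(2, n)`: the number of threshold functions of `n` variables. -/
def numThreshold (n : ℕ) : ℕ :=
  Nat.card {f : (Fin n → ℤˣ) → ℤˣ // IsThreshold f}

/-- The set `E = {(1, b₁, …, bₙ) | bᵢ = ±1} ⊆ ℝⁿ⁺¹`. -/
def cubeE (n : ℕ) : Finset (Fin (n + 1) → ℝ) :=
  Finset.univ.image fun b : Fin n → ℤˣ => Fin.cons 1 fun i => ((b i : ℤ) : ℝ)

/-- The set of ordered `n`-tuples `W` of vectors of `E` whose span has dimension `n`. -/
def indepTuples (n : ℕ) : Finset (Fin n → cubeE n) :=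
  Finset.univ.filter fun W =>
    Module.finrank ℝ
      (Submodule.span ℝ (Set.range fun k => (W k : Fin (n + 1) → ℝ))) = n

/-- `L_l(W)`: the span of the last `l` vectors of the tuple `W`, for `l ≤ n`
(with indices starting at `0`, these are the vectors `W k` with `n - l ≤ k`). -/
def flagSpace {n : ℕ} (W : Fin n → cubeE n) (l : ℕ) : Submodule ℝ (Fin (n + 1) → ℝ) :=
  Submodule.span ℝ ((fun k => (W k : Fin (n + 1) → ℝ)) '' {k : Fin n | n ≤ (k : ℕ) + l})

/-- `q_l^W = |L_l(W) ∩ E|`. -/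
def flagCount {n : ℕ} (W : Fin n → cubeE n) (l : ℕ) : ℕ :=
  ((cubeE n).filter fun v => v ∈ flagSpace W l).card

/-- `W[E] = q_n^W ⋯ q_1^W`. -/
def flagProd {n : ℕ} (W : Fin n → cubeE n) : ℕ :=
  ∏ l ∈ Finset.Icc 1 n, flagCount W l

/-- The sum over all linearly independent `n`-tuples `W` from `E` of
`(1 - ∑_{v ∈ L_n(W) ∩ E} p_v) / W[E]`, for weights `p` on `E`. -/
def flagSum (n : ℕ) (p : cubeE n → ℝ) : ℝ :=
  ∑ W ∈ indepTuples n,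
    (1 - ∑ v : cubeE n, if v.1 ∈ flagSpace W n then p v else 0) / (flagProd W : ℝ)

end

/-! Both sides are compared with the Möbius number |μ(⊥, ⊤)| of the lattice of flats of `E`.
Weisner's theorem writes |μ(⊥, F)|, for any point `a ∈ F` of `E`, as the sum of |μ(⊥, H)| over the
flats `H` with `a ∉ H` and `H ⊔ ⟨a⟩ = F`. Averaging over all such `a` and inducting on rank gives
the weighted tuple count (`sum_flagWeight`). Averaging the last step with the weights `p` instead
gives `flagSum_eq_absMoebius`, so `p` drops out.

For the bound, threshold functions dominate the chambers of the arrangement dual to `E`. By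
Zaslavsky there are at least ∑_H |μ(⊥, H)| of these. Weisner's theorem splits this sum evenly
between flats containing and avoiding `a`, whence the factor 2. -/

noncomputable section

open scoped Classical
open Module Submodule

variable {M : Type*} [AddCommGroup M] [Module ℝ M]

/-! ### Möbius numbers of flats -/

/-- The subspaces spanned by subsets of `E`. -/
def flats (E : Finset M) : Finset (Submodule ℝ M) :=
  E.powerset.image fun S : Finset M => span ℝ (S : Set M)

/-- The absolute value of the Möbius function between `⊥` and `F` in the lattice of subspaces
spanned by subsets of `E`, as given by the crosscut theorem. -/
def absMoebius (E : Finset M) (F : Submodule ℝ M) : ℝ :=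
  ∑ S ∈ E.powerset, if span ℝ (S : Set M) = F then (-1) ^ (S.card + finrank ℝ F) else 0

theorem span_mem_flats {E S : Finset M} (hS : S ∈ E.powerset) :
    span ℝ (S : Set M) ∈ flats E :=
  Finset.mem_image_of_mem _ hS

theorem sum_flats_mul_absMoebius (E : Finset M) (g : Submodule ℝ M → ℝ) :
    ∑ H ∈ flats E, g H * absMoebius E H =
      ∑ S ∈ E.powerset, g (span ℝ (S : Set M)) *
        (-1) ^ (S.card + finrank ℝ (span ℝ (S : Set M))) := by
  simp only [absMoebius, Finset.mul_sum, mul_ite, mul_zero]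
  rw [Finset.sum_comm]
  refine Finset.sum_congr rfl fun S hS => ?_
  rw [Finset.sum_ite_eq, if_pos (span_mem_flats hS)]

theorem span_coe_insert (a : M) (S : Finset M) :
    span ℝ ((insert a S : Finset M) : Set M) = span ℝ (S : Set M) ⊔ span ℝ {a} := by
  rw [Finset.coe_insert, span_insert, sup_comm]

theorem sup_span_singleton_eq_self {a : M} {H : Submodule ℝ M} (h : a ∈ H) :
    H ⊔ span ℝ {a} = H :=
  sup_eq_left.2 ((span_singleton_le_iff_mem _ _).2 h)

/-- Weisner's theorem for the lattice of flats. -/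
theorem absMoebius_eq_sum_flats [FiniteDimensional ℝ M] {E : Finset M} {a : M} (ha : a ∈ E)
    {F : Submodule ℝ M} (haF : a ∈ F) :
    absMoebius E F =
      ∑ H ∈ flats E, (if a ∉ H ∧ H ⊔ span ℝ {a} = F then 1 else 0) * absMoebius E H := by
  rw [sum_flats_mul_absMoebius, absMoebius, ← Finset.insert_erase ha]
  have hne : a ∉ E.erase a := Finset.notMem_erase a E
  -- Pair `S` with `insert a S`. If `a ∈ span S`, the two terms on the left cancel and those on the
  -- right vanish. Otherwise only `insert a S` survives on the left and only `S` on the right, with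
  -- equal signs because size and rank both grow by one.
  rw [Finset.sum_powerset_insert hne, Finset.sum_powerset_insert hne, ← Finset.sum_add_distrib,
    ← Finset.sum_add_distrib]
  refine Finset.sum_congr rfl fun S hS => ?_
  have haS : a ∉ S := fun h => hne (Finset.mem_powerset.1 hS h)
  rw [Finset.card_insert_of_notMem haS, span_coe_insert]
  have hmem : a ∈ span ℝ (S : Set M) ⊔ span ℝ {a} :=
    mem_sup_right (mem_span_singleton_self a)
  by_cases h : a ∈ span ℝ (S : Set M)
  · rw [sup_span_singleton_eq_self h]
    by_cases hF : span ℝ (S : Set M) = F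
    · simp [hF, haF, pow_succ, add_right_comm]
    · simp only [hF, h, not_true_eq_false, false_and, if_false, zero_mul]
  · have hF : span ℝ (S : Set M) ≠ F := fun e => h (e ▸ haF)
    by_cases h' : span ℝ (S : Set M) ⊔ span ℝ {a} = F
    · have := finrank_sup_span_singleton h
      rw [h'] at this
      simp [hF, h', h, haF, this, pow_add]
    · simp [hF, h', hmem]

theorem absMoebius_bot {E : Finset M} (h0 : (0 : M) ∉ E) : absMoebius E ⊥ = 1 := by
  rw [absMoebius, Finset.sum_eq_single ∅]
  · simp
  · intro S hS hne
    rw [if_neg]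
    intro h
    obtain ⟨x, hx⟩ := Finset.nonempty_iff_ne_empty.2 hne
    have : x = 0 := span_eq_bot.1 h x hx
    exact h0 (this ▸ Finset.mem_powerset.1 hS hx)
  · simp

theorem absMoebius_eq_zero {E : Finset M} {F : Submodule ℝ M} (hF : F ≠ ⊥)
    (h : ∀ a ∈ E, a ∉ F) : absMoebius E F = 0 := by
  refine Finset.sum_eq_zero fun S hS => if_neg fun e => ?_
  rcases S.eq_empty_or_nonempty with rfl | ⟨x, hx⟩
  · exact hF (by simpa using e.symm)
  · exact h x (Finset.mem_powerset.1 hS hx) (e ▸ subset_span hx)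

/-! ### Weighted counts of spanning tuples -/

/-- The span of the last `j` vectors of a tuple. -/
def tailSpan {E : Finset M} {l : ℕ} (W : Fin l → E) (j : ℕ) : Submodule ℝ M :=
  span ℝ ((fun k => (W k : M)) '' {k : Fin l | l ≤ (k : ℕ) + j})

/-- The reciprocal of the product of the numbers of points of `E` in the tail spans. -/
def flagWeight {E : Finset M} {l : ℕ} (W : Fin l → E) : ℝ :=
  ∏ j ∈ Finset.Icc 1 l, ((E.filter fun v => v ∈ tailSpan W j).card : ℝ)⁻¹

theorem tailSpan_self {E : Finset M} {l : ℕ} (W : Fin l → E) :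
    tailSpan W l = span ℝ (Set.range fun k => (W k : M)) := by
  simp [tailSpan]

theorem tailSpan_cons {E : Finset M} {l : ℕ} (w : E) (W : Fin l → E) {j : ℕ} (hj : j ≤ l) :
    tailSpan (Fin.cons w W : Fin (l + 1) → E) j = tailSpan W j := by
  unfold tailSpan
  congr 1
  ext x
  simp only [Set.mem_image, Set.mem_ofPred_eq, Fin.exists_fin_succ, Fin.cons_zero, Fin.cons_succ,
    Fin.val_zero, Fin.val_succ]
  constructor
  · rintro (⟨h, _⟩ | ⟨k, h, rfl⟩)
    · omega
    · exact ⟨k, by omega, rfl⟩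
  · rintro ⟨k, h, rfl⟩
    exact Or.inr ⟨k, by omega, rfl⟩

theorem span_range_cons {E : Finset M} {l : ℕ} (w : E) (W : Fin l → E) :
    span ℝ (Set.range fun k => ((Fin.cons w W : Fin (l + 1) → E) k : M)) =
      span ℝ (Set.range fun k => (W k : M)) ⊔ span ℝ {(w : M)} := by
  have : (Set.range fun k => ((Fin.cons w W : Fin (l + 1) → E) k : M)) =
      insert (w : M) (Set.range fun k => (W k : M)) := by
    ext x
    simp [Fin.exists_fin_succ, eq_comm]
  rw [this, span_insert, sup_comm]

theorem flagWeight_cons {E : Finset M} {l : ℕ} (w : E) (W : Fin l → E) :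
    flagWeight (Fin.cons w W : Fin (l + 1) → E) =
      flagWeight W * ((E.filter fun v =>
        v ∈ span ℝ (Set.range fun k => (W k : M)) ⊔ span ℝ {(w : M)}).card : ℝ)⁻¹ := by
  unfold flagWeight
  rw [Finset.prod_Icc_succ_top (by omega), tailSpan_self, span_range_cons]
  congr 1
  refine Finset.prod_congr rfl fun j hj => ?_
  rw [tailSpan_cons w W (Finset.mem_Icc.1 hj).2]

theorem span_range_mem_flats {E : Finset M} {l : ℕ} (W : Fin l → E) :
    span ℝ (Set.range fun k => (W k : M)) ∈ flats E := by
  refine Finset.mem_image.2 ⟨Finset.univ.image fun k => (W k : M), ?_, by simp⟩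
  rw [Finset.mem_powerset]
  intro x hx
  obtain ⟨k, -, rfl⟩ := Finset.mem_image.1 hx
  exact (W k).2

theorem notMem_of_finrank_sup_span_singleton {a : M} {H F : Submodule ℝ M}
    (h : H ⊔ span ℝ {a} = F) (hlt : finrank ℝ H < finrank ℝ F) : a ∉ H := by
  intro ha
  rw [sup_span_singleton_eq_self ha] at h
  rw [h] at hlt
  exact lt_irrefl _ hlt

theorem finrank_span_range_le {E : Finset M} {l : ℕ} (W : Fin l → E) :
    finrank ℝ (span ℝ (Set.range fun k => (W k : M))) ≤ l := by
  have h := finrank_range_le_card (R := ℝ) (fun k => (W k : M))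
  rwa [Fintype.card_fin] at h

/-- Weisner's theorem with each |μ(⊥, H)| expanded by the rank `l` count. It is kept for one fixed
`a`, so that it can be averaged over `a` uniformly or with the weights `p`. -/
theorem sum_flagWeight_sup [FiniteDimensional ℝ M] {E : Finset M} {l : ℕ}
    (ih : ∀ H : Submodule ℝ M, finrank ℝ H = l →
      ∑ W : Fin l → E, (if span ℝ (Set.range fun k => (W k : M)) = H then flagWeight W else 0) =
        absMoebius E H)
    {F : Submodule ℝ M} (hF : finrank ℝ F = l + 1) {a : M} (ha : a ∈ E) (haF : a ∈ F) :
    ∑ W : Fin l → E, (if span ℝ (Set.range fun k => (W k : M)) ⊔ span ℝ {a} = F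
      then flagWeight W else 0) = absMoebius E F := by
  have key : ∀ H ∈ flats E,
      (if a ∉ H ∧ H ⊔ span ℝ {a} = F then 1 else 0) * absMoebius E H =
      ∑ W : Fin l → E, if H = span ℝ (Set.range fun k => (W k : M)) then
        (if a ∉ H ∧ H ⊔ span ℝ {a} = F then flagWeight W else 0) else 0 := by
    intro H _
    by_cases h : a ∉ H ∧ H ⊔ span ℝ {a} = F
    · have hr := finrank_sup_span_singleton h.1
      rw [h.2, hF] at hr
      simp only [if_pos h, one_mul]
      rw [← ih H (by omega)]
      exact Finset.sum_congr rfl fun W _ => by simp only [eq_comm]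
    · simp [if_neg h]
  rw [absMoebius_eq_sum_flats ha haF, Finset.sum_congr rfl key, Finset.sum_comm]
  refine Finset.sum_congr rfl fun W _ => ?_
  rw [Finset.sum_ite_eq', if_pos (span_range_mem_flats W)]
  -- The condition `a ∉ H` is automatic: `l` vectors span rank at most `l`, less than that of `F`.
  refine if_congr ⟨fun h => ⟨?_, h⟩, And.right⟩ rfl rfl
  have := finrank_span_range_le W
  exact notMem_of_finrank_sup_span_singleton h (by omega)

/-- The weighted number of tuples spanning a subspace is the Möbius number of that subspace. -/
theorem sum_flagWeight [FiniteDimensional ℝ M] {E : Finset M} (h0 : (0 : M) ∉ E) :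
    ∀ (l : ℕ) (F : Submodule ℝ M), finrank ℝ F = l →
      ∑ W : Fin l → E, (if span ℝ (Set.range fun k => (W k : M)) = F then flagWeight W else 0) =
        absMoebius E F
  | 0, F, hF => by
    rw [finrank_eq_zero] at hF
    subst hF
    rw [absMoebius_bot h0, Fintype.sum_unique]
    simp [flagWeight]
  | l + 1, F, hF => by
    have hFbot : F ≠ ⊥ := by
      rintro rfl
      simp at hF
    set q : ℕ := (E.filter fun v => v ∈ F).card with hq
    -- Split off the first vector `w`. Each `w ∈ F` contributes the same amount, and the `q` such
    -- points cancel the factor `q⁻¹`.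
    have hsum : ∑ W : Fin (l + 1) → E,
        (if span ℝ (Set.range fun k => (W k : M)) = F then flagWeight W else 0) =
        ∑ w : E, (if (w : M) ∈ F then absMoebius E F * (q : ℝ)⁻¹ else 0) := by
      rw [← (Fin.consEquiv fun _ : Fin (l + 1) => (E : Type _)).sum_comp, Fintype.sum_prod_type]
      refine Finset.sum_congr rfl fun w _ => ?_
      simp only [Fin.consEquiv, Equiv.coe_fn_mk, span_range_cons, flagWeight_cons]
      by_cases hw : (w : M) ∈ F
      · rw [if_pos hw, ← sum_flagWeight_sup (sum_flagWeight h0 l) hF w.2 hw, Finset.sum_mul]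
        refine Finset.sum_congr rfl fun W _ => ?_
        split_ifs with h
        · rw [h]
        · simp
      · rw [if_neg hw]
        refine Finset.sum_eq_zero fun W _ => if_neg fun h => hw ?_
        exact h ▸ mem_sup_right (mem_span_singleton_self _)
    rw [hsum, Finset.sum_coe_sort E fun w => if w ∈ F then absMoebius E F * (q : ℝ)⁻¹ else 0,
      ← Finset.sum_filter, Finset.sum_const, ← hq, nsmul_eq_mul]
    by_cases hq0 : q = 0
    · rw [absMoebius_eq_zero hFbot]
      · simp
      · simpa [hq, Finset.filter_eq_empty_iff] using hq0
    · field_simp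

theorem absMoebius_nonneg [FiniteDimensional ℝ M] {E : Finset M} (h0 : (0 : M) ∉ E)
    (F : Submodule ℝ M) : 0 ≤ absMoebius E F := by
  rw [← sum_flagWeight h0 _ F rfl]
  refine Finset.sum_nonneg fun W _ => ?_
  split_ifs
  · exact Finset.prod_nonneg fun j _ => by positivity
  · exact le_rfl

/-- The right side is the sum of the Möbius numbers of all flats. Half of it comes from the flats
through `a`, and `F` is one nonnegative term of that half. -/
theorem two_mul_absMoebius_le_sum [FiniteDimensional ℝ M] {E : Finset M} (h0 : (0 : M) ∉ E)
    {a : M} (ha : a ∈ E) {F : Submodule ℝ M} (haF : a ∈ F) :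
    2 * absMoebius E F ≤
      ∑ S ∈ E.powerset, (-1) ^ (S.card + finrank ℝ (span ℝ (S : Set M))) := by
  have hsplit := sum_flats_mul_absMoebius E fun _ => 1
  simp only [one_mul] at hsplit
  rw [← hsplit, ← Finset.sum_filter_add_sum_filter_not (flats E) fun H => a ∈ H]
  have hEq : ∑ H ∈ flats E with a ∈ H, absMoebius E H =
      ∑ H ∈ flats E with a ∉ H, absMoebius E H := by
    rw [Finset.sum_congr rfl fun H hH =>
      absMoebius_eq_sum_flats ha (Finset.mem_filter.1 hH).2, Finset.sum_comm, Finset.sum_filter]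
    -- Each flat `H` avoiding `a` is counted once, in the Weisner sum of `H ⊔ ⟨a⟩`.
    refine Finset.sum_congr rfl fun H hH => ?_
    rw [← Finset.sum_mul]
    by_cases h : a ∈ H
    · simp [h]
    · simp only [h, not_false_eq_true, true_and, if_true]
      rw [Finset.sum_ite_eq, if_pos, one_mul]
      refine Finset.mem_filter.2 ⟨?_, mem_sup_right (mem_span_singleton_self a)⟩
      obtain ⟨S, hS, rfl⟩ := Finset.mem_image.1 hH
      refine Finset.mem_image.2 ⟨insert a S, ?_, span_coe_insert a S⟩
      exact Finset.mem_powerset.2 (Finset.insert_subset ha (Finset.mem_powerset.1 hS))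
  rw [← hEq, ← two_mul]
  refine mul_le_mul_of_nonneg_left ?_ zero_le_two
  by_cases hF : F ∈ flats E
  · exact Finset.single_le_sum (f := absMoebius E) (fun H _ => absMoebius_nonneg h0 H)
      (Finset.mem_filter.2 ⟨hF, haF⟩)
  · have : absMoebius E F = 0 := by
      refine Finset.sum_eq_zero fun S hS => if_neg fun e => hF ?_
      exact e ▸ span_mem_flats hS
    rw [this]
    exact Finset.sum_nonneg fun H _ => absMoebius_nonneg h0 H

/-! ### Chambers and Zaslavsky's lower bound -/

/-- A linear form vanishing on `U` is nonzero on every vector of `A` and is positive exactly on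
those in `P`. -/
def SeparatesFrom (A : Finset M) (U : Submodule ℝ M) (P : Finset M) (φ : Dual ℝ M) : Prop :=
  U ≤ LinearMap.ker φ ∧ ∀ x ∈ A, (x ∈ P → 0 < φ x) ∧ (x ∉ P → φ x < 0)

/-- The chambers cut out by the vectors of `A` in the annihilator of `U`, each encoded by the set
of vectors that are positive on it. -/
def chambers (A : Finset M) (U : Submodule ℝ M) : Finset (Finset M) :=
  A.powerset.filter fun P => ∃ φ, SeparatesFrom A U P φ

theorem exists_pos_forall_mul_lt (A : Finset M) (φ ψ : Dual ℝ M) :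
    ∃ t : ℝ, 0 < t ∧ ∀ x ∈ A, φ x ≠ 0 → t * |ψ x| < |φ x| := by
  have h : ∀ᶠ t : ℝ in nhdsWithin 0 (Set.Ioi 0), ∀ x ∈ A, φ x ≠ 0 → t * |ψ x| < |φ x| := by
    rw [Filter.eventually_all_finset]
    intro x _
    by_cases hx : φ x = 0
    · simp [hx]
    · have hc : Filter.Tendsto (fun t : ℝ => t * |ψ x|) (nhdsWithin 0 (Set.Ioi 0))
          (nhds (0 * |ψ x|)) :=
        ((continuous_id.mul continuous_const).tendsto 0).mono_left nhdsWithin_le_nhds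
      rw [zero_mul] at hc
      filter_upwards [hc.eventually (gt_mem_nhds (abs_pos.2 hx))] with t ht _ using ht
  obtain ⟨t, ht, ht0⟩ := (h.and self_mem_nhdsWithin).exists
  exact ⟨t, ht0, ht⟩

theorem SeparatesFrom.exists_perturb {A : Finset M} {U : Submodule ℝ M} {P : Finset M}
    {φ : Dual ℝ M} (h : SeparatesFrom A U P φ) {ψ : Dual ℝ M} (hψ : U ≤ LinearMap.ker ψ) :
    ∃ t : ℝ, 0 < t ∧ SeparatesFrom A U P (φ + t • ψ) := by
  obtain ⟨t, ht, hA⟩ := exists_pos_forall_mul_lt A φ ψ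
  refine ⟨t, ht, fun u hu => ?_, fun x hx => ⟨fun hP => ?_, fun hP => ?_⟩⟩
  · have h1 : φ u = 0 := h.1 hu
    have h2 : ψ u = 0 := hψ hu
    simp [h1, h2]
  · have hpos := (h.2 x hx).1 hP
    have := hA x hx hpos.ne'
    rw [abs_of_pos hpos] at this
    have h3 := mul_le_mul_of_nonneg_left (neg_abs_le (ψ x)) ht.le
    simp only [LinearMap.add_apply, LinearMap.smul_apply, smul_eq_mul]
    linarith
  · have hneg := (h.2 x hx).2 hP
    have := hA x hx hneg.ne
    rw [abs_of_neg hneg] at this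
    have h3 := mul_le_mul_of_nonneg_left (le_abs_self (ψ x)) ht.le
    simp only [LinearMap.add_apply, LinearMap.smul_apply, smul_eq_mul]
    linarith

theorem SeparatesFrom.insert_of_neg {A : Finset M} {U : Submodule ℝ M} {P : Finset M}
    {φ : Dual ℝ M} (h : SeparatesFrom A U P φ) {a : M} (haP : a ∉ P) (ha : φ a < 0) :
    SeparatesFrom (insert a A) U P φ := by
  refine ⟨h.1, fun x hx => ?_⟩
  rcases Finset.mem_insert.1 hx with rfl | hx
  · exact ⟨fun h => absurd h haP, fun _ => ha⟩
  · exact h.2 x hx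

theorem SeparatesFrom.insert_of_pos {A : Finset M} {U : Submodule ℝ M} {P : Finset M}
    {φ : Dual ℝ M} (h : SeparatesFrom A U P φ) {a : M} (haA : a ∉ A) (ha : 0 < φ a) :
    SeparatesFrom (insert a A) U (insert a P) φ := by
  refine ⟨h.1, fun x hx => ?_⟩
  rcases Finset.mem_insert.1 hx with rfl | hx
  · exact ⟨fun _ => ha, fun h => absurd (Finset.mem_insert_self _ _) h⟩
  · have hne : x ≠ a := fun e => haA (e ▸ hx)
    simpa [hne] using h.2 x hx

/-- Deletion and restriction of a hyperplane: the inequality needed for a lower bound. -/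
theorem card_chambers_insert_ge {A : Finset M} {U : Submodule ℝ M} {a : M} (haA : a ∉ A)
    (haU : a ∉ U) :
    (chambers A U).card + (chambers A (U ⊔ span ℝ {a})).card ≤ (chambers (insert a A) U).card := by
  obtain ⟨ψ, hψa, hψU⟩ := exists_le_ker_of_notMem haU
  -- `X` and `Y` collect the old sign patterns realised on the negative and positive side of `a`.
  -- Every old chamber meets a side, after a perturbation along `ψ` if needed; a chamber of the
  -- restriction to `a = 0` extends to both.
  set X := A.powerset.filter fun P => ∃ φ, SeparatesFrom (insert a A) U P φ
  set Y := A.powerset.filter fun P => ∃ φ, SeparatesFrom (insert a A) U (insert a P) φ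
  have hcard : (chambers (insert a A) U).card = X.card + Y.card := by
    rw [chambers, Finset.card_filter, Finset.sum_powerset_insert haA, Finset.card_filter,
      Finset.card_filter]
  have hunion : chambers A U ⊆ X ∪ Y := by
    intro P hP
    obtain ⟨hPA, φ, hφ⟩ := Finset.mem_filter.1 hP
    have haP : a ∉ P := fun h => haA (Finset.mem_powerset.1 hPA h)
    have hgen : ∀ φ', SeparatesFrom A U P φ' → φ' a ≠ 0 → P ∈ X ∪ Y := by
      intro φ' hφ' hne
      rcases lt_or_gt_of_ne hne with hneg | hpos
      · exact Finset.mem_union_left _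
          (Finset.mem_filter.2 ⟨hPA, φ', hφ'.insert_of_neg haP hneg⟩)
      · exact Finset.mem_union_right _
          (Finset.mem_filter.2 ⟨hPA, φ', hφ'.insert_of_pos haA hpos⟩)
    by_cases h0 : φ a = 0
    · obtain ⟨t, ht, hφ'⟩ := hφ.exists_perturb hψU
      exact hgen _ hφ' (by simp [h0, ht.ne', hψa])
    · exact hgen φ hφ h0
  have hinter : chambers A (U ⊔ span ℝ {a}) ⊆ X ∩ Y := by
    intro P hP
    obtain ⟨hPA, φ, hφ⟩ := Finset.mem_filter.1 hP
    have haP : a ∉ P := fun h => haA (Finset.mem_powerset.1 hPA h)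
    have hφa : φ a = 0 := hφ.1 (mem_sup_right (mem_span_singleton_self a))
    have hφ' : SeparatesFrom A U P φ := ⟨le_sup_left.trans hφ.1, hφ.2⟩
    obtain ⟨ψ', hψ', hψ'U⟩ : ∃ ψ' : Dual ℝ M, 0 < ψ' a ∧ U ≤ LinearMap.ker ψ' := by
      rcases lt_or_gt_of_ne hψa with hneg | hpos
      · exact ⟨-ψ, by simpa using hneg, fun u hu => by simpa using hψU hu⟩
      · exact ⟨ψ, hpos, hψU⟩
    refine Finset.mem_inter.2 ⟨Finset.mem_filter.2 ⟨hPA, ?_⟩, Finset.mem_filter.2 ⟨hPA, ?_⟩⟩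
    · obtain ⟨t, ht, hs⟩ := hφ'.exists_perturb (ψ := -ψ') fun u hu => by simpa using hψ'U hu
      exact ⟨_, hs.insert_of_neg haP (by simp [hφa, mul_pos ht hψ'])⟩
    · obtain ⟨t, ht, hs⟩ := hφ'.exists_perturb hψ'U
      exact ⟨_, hs.insert_of_pos haA (by simp [hφa, mul_pos ht hψ'])⟩
  rw [hcard, ← Finset.card_union_add_card_inter X Y]
  exact add_le_add (Finset.card_le_card hunion) (Finset.card_le_card hinter)

/-- The lower bound in Zaslavsky's formula for the number of chambers. -/
theorem sum_powerset_le_card_chambers [FiniteDimensional ℝ M] (A : Finset M) :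
    ∀ U : Submodule ℝ M,
      ∑ S ∈ A.powerset, (-1 : ℝ) ^ (S.card + finrank ℝ (U ⊔ span ℝ (S : Set M) : Submodule ℝ M)
        + finrank ℝ U) ≤ (chambers A U).card := by
  induction A using Finset.induction_on with
  | empty =>
    intro U
    have : chambers (∅ : Finset M) U = {∅} := by
      ext P
      simp only [chambers, SeparatesFrom, Finset.mem_filter, Finset.powerset_empty,
        Finset.mem_singleton, Finset.notMem_empty, false_imp_iff, implies_true, and_true]
      exact ⟨And.left, fun h => ⟨h, 0, fun u _ => by simp⟩⟩
    rw [this, Finset.powerset_empty, Finset.sum_singleton, Finset.coe_empty, span_empty,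
      sup_bot_eq, Finset.card_empty, zero_add, ← two_mul, pow_mul]
    simp
  | insert a A haA ih =>
    intro U
    have hins : ∀ S ∈ A.powerset, (-1 : ℝ) ^ ((insert a S).card +
        finrank ℝ (U ⊔ span ℝ ((insert a S : Finset M) : Set M) : Submodule ℝ M) + finrank ℝ U) =
        (-1 : ℝ) ^ (S.card + 1 +
          finrank ℝ (U ⊔ span ℝ {a} ⊔ span ℝ (S : Set M) : Submodule ℝ M) + finrank ℝ U) := by
      intro S hS
      have haS : a ∉ S := fun h => haA (Finset.mem_powerset.1 hS h)
      rw [Finset.card_insert_of_notMem haS, span_coe_insert, sup_comm (span ℝ (S : Set M)),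
        sup_assoc]
    rw [Finset.sum_powerset_insert haA, Finset.sum_congr rfl hins]
    -- If `a ∈ U`, then `S` and `insert a S` have the same join with `U` and opposite signs, so the
    -- sum is zero.
    by_cases haU : a ∈ U
    · rw [sup_span_singleton_eq_self haU, ← Finset.sum_add_distrib, Finset.sum_eq_zero]
      · positivity
      · intro S _
        ring
    · refine le_trans ?_ (Nat.cast_le.2 (card_chambers_insert_ge haA haU))
      rw [Nat.cast_add]
      refine add_le_add (ih U) ((ih (U ⊔ span ℝ {a})).trans' (le_of_eq ?_))
      refine Finset.sum_congr rfl fun S _ => ?_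
      rw [finrank_sup_span_singleton haU]
      ring

theorem two_mul_absMoebius_le_card_chambers [FiniteDimensional ℝ M] {E : Finset M}
    (h0 : (0 : M) ∉ E) (hE : E.Nonempty) : 2 * absMoebius E ⊤ ≤ (chambers E ⊥).card := by
  obtain ⟨a, ha⟩ := hE
  refine (two_mul_absMoebius_le_sum h0 ha mem_top).trans ?_
  refine (sum_powerset_le_card_chambers E ⊥).trans' (le_of_eq ?_)
  refine Finset.sum_congr rfl fun S _ => ?_
  rw [bot_sup_eq, finrank_bot, add_zero]

/-! ### Application to the cube -/

/-- The vector `(1, b₁, …, bₙ)` of `E`. -/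
def cubePoint {n : ℕ} (b : Fin n → ℤˣ) : Fin (n + 1) → ℝ :=
  Fin.cons 1 fun i => ((b i : ℤ) : ℝ)

theorem cubePoint_mem {n : ℕ} (b : Fin n → ℤˣ) : cubePoint b ∈ cubeE n :=
  Finset.mem_image_of_mem _ (Finset.mem_univ b)

theorem zero_notMem_cubeE (n : ℕ) : (0 : Fin (n + 1) → ℝ) ∉ cubeE n := by
  intro h
  obtain ⟨b, -, hb⟩ := Finset.mem_image.1 h
  simpa using congrFun hb 0

theorem apply_cubePoint {n : ℕ} (φ : Dual ℝ (Fin (n + 1) → ℝ)) (b : Fin n → ℤˣ) :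
    φ (cubePoint b) = (∑ i : Fin n, φ (Pi.single i.succ 1) * ((b i : ℤ) : ℝ)) +
      φ (Pi.single 0 1) := by
  rw [LinearMap.pi_apply_eq_sum_univ φ (cubePoint b), Fin.sum_univ_succ, add_comm]
  have hs : ∀ i : Fin (n + 1), (fun j => if i = j then (1 : ℝ) else 0) = Pi.single i 1 := by
    intro i
    ext j
    simp [Pi.single_apply, eq_comm]
  simp [hs, cubePoint, mul_comm]

/-- A form on `ℝⁿ⁺¹` is an affine form on the cube. Inside a chamber it has no zeros on `E`, so `≥
0` and `> 0` agree and the chamber can be recovered from its threshold function. -/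
theorem card_chambers_cubeE_le_numThreshold (n : ℕ) :
    (chambers (cubeE n) ⊥).card ≤ numThreshold n := by
  have hthr : ∀ P ∈ chambers (cubeE n) ⊥,
      IsThreshold fun b : Fin n → ℤˣ => if cubePoint b ∈ P then 1 else -1 := by
    intro P hP
    obtain ⟨-, φ, hφ⟩ := Finset.mem_filter.1 hP
    refine ⟨φ (Pi.single 0 1), fun i => φ (Pi.single i.succ 1), fun b => ?_⟩
    rw [← apply_cubePoint]
    have := hφ.2 _ (cubePoint_mem b)
    by_cases hb : cubePoint b ∈ P
    · simpa [hb] using (this.1 hb).le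
    · simpa [hb] using this.2 hb
  rw [numThreshold, ← Nat.card_eq_finsetCard]
  refine Nat.card_le_card_of_injective
    (fun P : chambers (cubeE n) ⊥ => (⟨_, hthr P.1 P.2⟩ : {f // IsThreshold f})) ?_
  intro P Q hPQ
  have hiff : ∀ b : Fin n → ℤˣ, cubePoint b ∈ P.1 ↔ cubePoint b ∈ Q.1 := by
    intro b
    have := congrFun (Subtype.ext_iff.1 hPQ) b
    by_cases hP : cubePoint b ∈ P.1 <;> by_cases hQ : cubePoint b ∈ Q.1 <;>
      simp_all
  have hsub : ∀ R : chambers (cubeE n) ⊥, R.1 ⊆ cubeE n := fun R =>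
    Finset.mem_powerset.1 (Finset.mem_filter.1 R.2).1
  refine Subtype.ext (Finset.ext fun x => ?_)
  by_cases hx : x ∈ cubeE n
  · obtain ⟨b, -, rfl⟩ := Finset.mem_image.1 hx
    exact hiff b
  · exact ⟨fun h => absurd (hsub P h) hx, fun h => absurd (hsub Q h) hx⟩

theorem flagSum_eq_absMoebius (n : ℕ) (p : cubeE n → ℝ) (hp : ∑ v, p v = 1) :
    flagSum n p = absMoebius (cubeE n) ⊤ := by
  have hterm : ∀ W : Fin n → cubeE n,
      (if finrank ℝ (span ℝ (Set.range fun k => (W k : Fin (n + 1) → ℝ))) = n then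
        (1 - ∑ v : cubeE n, if v.1 ∈ flagSpace W n then p v else 0) / (flagProd W : ℝ) else 0) =
      ∑ v : cubeE n, p v * (if span ℝ (Set.range fun k => (W k : Fin (n + 1) → ℝ)) ⊔
        span ℝ {(v : Fin (n + 1) → ℝ)} = ⊤ then flagWeight W else 0) := by
    intro W
    have hspace : flagSpace W n = span ℝ (Set.range fun k => (W k : Fin (n + 1) → ℝ)) :=
      tailSpan_self W
    have hprod : ((flagProd W : ℕ) : ℝ)⁻¹ = flagWeight W := by
      rw [flagProd, Nat.cast_prod, ← Finset.prod_inv_distrib]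
      rfl
    have hle := finrank_span_range_le W
    rw [hspace, div_eq_mul_inv, hprod]
    set H := span ℝ (Set.range fun k => (W k : Fin (n + 1) → ℝ))
    by_cases hH : finrank ℝ H = n
    -- Since the weights sum to 1, the numerator is the total weight of the points outside `H`,
    -- which are those completing the hyperplane `H` to `⊤`.
    · rw [if_pos hH, ← hp, ← Finset.sum_sub_distrib, Finset.sum_mul]
      refine Finset.sum_congr rfl fun v _ => ?_
      by_cases hv : (v : Fin (n + 1) → ℝ) ∈ H
      · have hne : H ≠ ⊤ := by
          intro h
          rw [h, finrank_top, finrank_fin_fun] at hH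
          omega
        rw [sup_span_singleton_eq_self hv]
        simp [hv, hne]
      · have htop : H ⊔ span ℝ {(v : Fin (n + 1) → ℝ)} = ⊤ := by
          apply eq_top_of_finrank_eq
          rw [finrank_sup_span_singleton hv, hH, finrank_fin_fun]
        simp [hv, htop]
    · rw [if_neg hH, Finset.sum_eq_zero]
      intro v _
      rw [if_neg, mul_zero]
      intro h
      have hv : (v : Fin (n + 1) → ℝ) ∉ H := by
        apply notMem_of_finrank_sup_span_singleton h
        rw [finrank_top, finrank_fin_fun]
        omega
      have := finrank_sup_span_singleton hv
      rw [h, finrank_top, finrank_fin_fun] at this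
      omega
  rw [flagSum, indepTuples, Finset.sum_filter, Finset.sum_congr rfl fun W _ => hterm W,
    Finset.sum_comm]
  have hv : ∀ v : cubeE n, ∑ W : Fin n → cubeE n, p v * (if
      span ℝ (Set.range fun k => (W k : Fin (n + 1) → ℝ)) ⊔
        span ℝ {(v : Fin (n + 1) → ℝ)} = ⊤ then flagWeight W else 0) =
      p v * absMoebius (cubeE n) ⊤ := by
    intro v
    rw [← Finset.mul_sum, sum_flagWeight_sup (sum_flagWeight (zero_notMem_cubeE n) n)
      (by rw [finrank_top, finrank_fin_fun]) v.2 mem_top]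
  rw [Finset.sum_congr rfl fun v _ => hv v, ← Finset.sum_mul, hp, one_mul]

end

theorem mainTheorem2 (n : ℕ) :
    (∀ p : cubeE n → ℝ, ∑ v, p v = 1 → (numThreshold n : ℝ) ≥ 2 * flagSum n p) ∧
    (∀ p p' : cubeE n → ℝ, ∑ v, p v = 1 → ∑ v, p' v = 1 →
      2 * flagSum n p = 2 * flagSum n p') := by
  refine ⟨fun p hp => ?_, fun p p' hp hp' => ?_⟩
  · rw [flagSum_eq_absMoebius n p hp]
    exact (two_mul_absMoebius_le_card_chambers (zero_notMem_cubeE n) ⟨_, cubePoint_mem 1⟩).trans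
      (Nat.cast_le.2 (card_chambers_cubeE_le_numThreshold n))
  · rw [flagSum_eq_absMoebius n p hp, flagSum_eq_absMoebius n p' hp']
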